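/- A \emph{rectilinear (straight-line) drawing} of $K_n$ places the $n$ vertices at distinct points of the plane, no three of them collinear, and represents each edge by the segment joining its end points, such that no three edges share an interior point. A \emph{crossing} is a common interior point of two distinct edges. \textbf{Theorem.} There is an absolute constant $c>0$ such that for every nonnegative integer $n\neq 1$ and every integer $k$ with $0\le k\le\left\lfloor \frac{(n-2)^2}{4}\right\rfloor$ there is a rectilinear drawing of $K_n$ in which at least $cn$ edges are each involved in exactly $k$ crossings. -/

import Mathlib

/-- The edge with end points `e` drawn without its end points, when each vertex `v` is placed at
the point `p v` of the plane and edges are drawn as line segments. -/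
def edgeInterior {V : Type*} (p : V → EuclideanSpace ℝ (Fin 2)) (e : Sym2 V) :
    Set (EuclideanSpace ℝ (Fin 2)) :=
  Sym2.lift ⟨fun a b => openSegment ℝ (p a) (p b), fun a b => openSegment_symm ℝ (p a) (p b)⟩ e

/-- A rectilinear (straight-line) drawing of a graph: distinct vertices go to distinct points of
the plane, no three of which are collinear, every edge is the segment between its end points, and
no three edges share an interior point. General position of the vertices implies that no edge
passes through a vertex other than its end points, that two distinct edges share at most one
point, and that they are not tangent there. -/
structure RectilinearDrawing {V : Type*} (G : SimpleGraph V) where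
  /-- The position of each vertex. -/
  pos : V → EuclideanSpace ℝ (Fin 2)
  injective : Function.Injective pos
  generalPosition : ∀ a b c : V, a ≠ b → a ≠ c → b ≠ c → ¬ Collinear ℝ {pos a, pos b, pos c}
  noTriplePoint : ∀ e ∈ G.edgeSet, ∀ f ∈ G.edgeSet, ∀ g ∈ G.edgeSet, e ≠ f → e ≠ g → f ≠ g →
    edgeInterior pos e ∩ edgeInterior pos f ∩ edgeInterior pos g = ∅

namespace RectilinearDrawing

variable {V : Type*} {G : SimpleGraph V}

/-- The crossings that the edge `e` takes part in: the interior points of `e` which are also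
interior points of another edge. -/
def crossingsOn (D : RectilinearDrawing G) (e : Sym2 V) : Set (EuclideanSpace ℝ (Fin 2)) :=
  {x | x ∈ edgeInterior D.pos e ∧ ∃ f ∈ G.edgeSet, f ≠ e ∧ x ∈ edgeInterior D.pos f}

/-- The `k`-crossing set: the edges that are part of exactly `k` crossings. -/
def crossingSet (D : RectilinearDrawing G) (k : ℕ) : Set (Sym2 V) :=
  {e | e ∈ G.edgeSet ∧ (D.crossingsOn e).encard = k}

/-- The `k`-crossing index: the number of edges (of a finite graph) that are part of exactly `k`
crossings. -/
noncomputable def crossingIndex (D : RectilinearDrawing G) (k : ℕ) : ℕ :=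
  (D.crossingSet k).ncard

end RectilinearDrawing

/-! Put the vertices `0, …, n - 1` in order on a parabola. In this convex position the chord from
`i` to `i + m` is crossed by `(m - 1) * (n - 1 - m)` edges. Up to `m = n / 2` this product grows
from `0` to the bound on `k`. Take the least `m` for which it is at least `k`, and let `r` be the
excess (`exists_chord_length`).

To lose exactly `r` crossings, move `i` very close to `i + 1`, on the segment from `i + 1` to a
point of the parabola that separates the `r` cyclic predecessors of `i` from the other vertices. The
only triples reversed are those formed by `i`, `i + 1` and one of these predecessors
(`eventually_orient_pushed`). Hence exactly the `r` edges from `i + 1` to them stop crossing the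
chord (`exists_mem_iff_mem_crossingPairs`).

All `i` in a set `S` can be moved at once if the moves do not interfere, which only forbids five
differences within `S`. A maximal such `S` has linear size (`exists_avoidsDiff`), and each of its
elements starts a chord with `k` crossings.

Crossings depend only on the orientations of triples, and these survive small perturbations. A
generic one removes triple points (`exists_sameOrient_noTriple`), so that crossings on an edge
correspond to edges crossing it. -/

/-! ### Signed areas and crossing segments -/

/-- Twice the signed area of the triangle `x y z`. -/
def orient (x y z : EuclideanSpace ℝ (Fin 2)) : ℝ :=
  (y 0 - x 0) * (z 1 - x 1) - (y 1 - x 1) * (z 0 - x 0)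

theorem orient_rotate (x y z : EuclideanSpace ℝ (Fin 2)) : orient y z x = orient x y z := by
  unfold orient; ring

theorem orient_swap (x y z : EuclideanSpace ℝ (Fin 2)) : orient y x z = -orient x y z := by
  unfold orient; ring

theorem orient_swap_right (x y z : EuclideanSpace ℝ (Fin 2)) :
    orient x z y = -orient x y z := by
  unfold orient; ring

theorem orient_combo (x y u v : EuclideanSpace ℝ (Fin 2)) {a b : ℝ} (h : a + b = 1) :
    orient x y (a • u + b • v) = a * orient x y u + b * orient x y v := by
  obtain rfl : b = 1 - a := by linarith
  simp only [orient, PiLp.add_apply, PiLp.smul_apply, smul_eq_mul]; ring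

theorem orient_self_right (x y : EuclideanSpace ℝ (Fin 2)) : orient x y y = 0 := by
  unfold orient; ring

theorem orient_self_left (x y : EuclideanSpace ℝ (Fin 2)) : orient x y x = 0 := by
  unfold orient; ring

theorem orient_self (x y : EuclideanSpace ℝ (Fin 2)) : orient x x y = 0 := by
  unfold orient; ring

theorem continuous_orient : Continuous fun t : EuclideanSpace ℝ (Fin 2) ×
    EuclideanSpace ℝ (Fin 2) × EuclideanSpace ℝ (Fin 2) => orient t.1 t.2.1 t.2.2 := by
  unfold orient; fun_prop

theorem orient_eq_zero_of_collinear {x y z : EuclideanSpace ℝ (Fin 2)}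
    (h : Collinear ℝ {x, y, z}) : orient x y z = 0 := by
  obtain ⟨v, hv⟩ := (collinear_iff_of_mem (p₀ := x) (by simp)).1 h
  obtain ⟨s, hs⟩ := hv y (by simp)
  obtain ⟨t, ht⟩ := hv z (by simp)
  subst hs ht
  simp only [orient, vadd_eq_add, PiLp.add_apply, PiLp.smul_apply, smul_eq_mul]; ring

theorem orient_eq_zero_of_mem_openSegment {x y z : EuclideanSpace ℝ (Fin 2)}
    (h : z ∈ openSegment ℝ x y) : orient x y z = 0 := by
  obtain ⟨a, b, -, -, hab, rfl⟩ := h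
  rw [orient_combo _ _ _ _ hab, orient_self_left, orient_self_right]; ring

/-- The end points of a segment crossing the line `x y` lie on different sides of it. -/
theorem orient_mul_orient_neg {x y u v z : EuclideanSpace ℝ (Fin 2)} (h₁ : z ∈ openSegment ℝ x y)
    (h₂ : z ∈ openSegment ℝ u v) (h : orient x y u ≠ 0) : orient x y u * orient x y v < 0 := by
  have h0 := orient_eq_zero_of_mem_openSegment h₁
  obtain ⟨a, b, ha, hb, hab, rfl⟩ := h₂
  rw [orient_combo _ _ _ _ hab] at h0
  have h3 : b * (orient x y u * orient x y v) = -(a * (orient x y u * orient x y u)) := by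
    linear_combination orient x y u * h0
  have h4 : 0 < a * (orient x y u * orient x y u) := mul_pos ha (mul_self_pos.2 h)
  by_contra! h5
  have := mul_nonneg hb.le h5
  linarith

theorem exists_mem_openSegment {x y u v : EuclideanSpace ℝ (Fin 2)}
    (h₁ : orient x y u * orient x y v < 0) (h₂ : orient u v x * orient u v y < 0) :
    ∃ z, z ∈ openSegment ℝ x y ∧ z ∈ openSegment ℝ u v := by
  have key : ∀ s t : ℝ, s * t < 0 → 0 < t / (t - s) ∧ 0 < -s / (t - s) ∧
      t / (t - s) + -s / (t - s) = 1 := by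
    intro s t hst
    have hne : t - s ≠ 0 := by
      intro h
      obtain rfl : t = s := by linarith
      exact absurd hst (not_lt.2 (mul_self_nonneg _))
    refine ⟨?_, ?_, by field_simp; ring⟩
    · rcases mul_neg_iff.1 hst with h | h
      · exact div_pos_of_neg_of_neg h.2 (by linarith)
      · exact div_pos h.2 (by linarith)
    · rcases mul_neg_iff.1 hst with h | h
      · exact div_pos_of_neg_of_neg (by linarith) (by linarith)
      · exact div_pos (by linarith) (by linarith)
  obtain ⟨a1, b1, c1⟩ := key _ _ h₁
  obtain ⟨a2, b2, c2⟩ := key _ _ h₂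
  -- The weights on `x y` come from signed areas over the line `u v`, and conversely. By `e` the two
  -- denominators differ only in sign.
  refine ⟨_, ⟨_, _, a2, b2, c2, rfl⟩, ⟨_, _, a1, b1, c1, ?_⟩⟩
  have e : orient x y v - orient x y u = -(orient u v y - orient u v x) := by
    unfold orient; ring
  have hne : orient u v y - orient u v x ≠ 0 := by
    intro h; rw [h] at c2; simp at c2
  rw [e]
  ext j
  fin_cases j <;>
  · simp only [PiLp.add_apply, PiLp.smul_apply, smul_eq_mul]
    field_simp
    simp only [orient]
    simp
    ring

theorem not_mem_openSegment_of_common_endpoint {x y z w : EuclideanSpace ℝ (Fin 2)}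
    (h : orient x y z ≠ 0) (h₁ : w ∈ openSegment ℝ x y) : w ∉ openSegment ℝ x z := by
  intro h₂
  have h0 := orient_eq_zero_of_mem_openSegment h₁
  obtain ⟨a, b, ha, hb, hab, rfl⟩ := h₂
  rw [orient_combo _ _ _ _ hab, orient_self_left] at h0
  have : b * orient x y z = 0 := by linarith
  rcases mul_eq_zero.1 this with h' | h'
  · exact hb.ne' h'
  · exact h h'

/-- Two crossing segments have only one common point. -/
theorem eq_of_mem_openSegment {x y u v z w : EuclideanSpace ℝ (Fin 2)} (h : orient x y u ≠ 0)
    (hz₁ : z ∈ openSegment ℝ x y) (hz₂ : z ∈ openSegment ℝ u v)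
    (hw₁ : w ∈ openSegment ℝ x y) (hw₂ : w ∈ openSegment ℝ u v) : z = w := by
  have hneg := orient_mul_orient_neg hz₁ hz₂ h
  have h0 := orient_eq_zero_of_mem_openSegment hz₁
  have h1 := orient_eq_zero_of_mem_openSegment hw₁
  obtain ⟨a, b, ha, hb, hab, rfl⟩ := hz₂
  obtain ⟨a', b', ha', hb', hab', rfl⟩ := hw₂
  rw [orient_combo _ _ _ _ hab] at h0
  rw [orient_combo _ _ _ _ hab'] at h1
  have hne : orient x y u - orient x y v ≠ 0 := by
    intro h2
    rw [sub_eq_zero.1 h2] at hneg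
    exact absurd hneg (not_lt.2 (mul_self_nonneg _))
  have : (a - a') * (orient x y u - orient x y v) = 0 := by
    obtain rfl : b = 1 - a := by linarith
    obtain rfl : b' = 1 - a' := by linarith
    linear_combination h0 - h1
  have h3 : a = a' := by
    rcases mul_eq_zero.1 this with h' | h'
    · linarith
    · exact absurd h' hne
  subst h3
  obtain rfl : b = b' := by linarith
  rfl

/-! ### Generic perturbation -/

open MeasureTheory in
/-- A point can be moved a little so as to avoid finitely many null sets. -/
theorem exists_mem_forall_notMem_of_null {ι : Type*} [Finite ι]
    (B : ι → Set (EuclideanSpace ℝ (Fin 2))) (hB : ∀ i, volume (B i) = 0)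
    {U : Set (EuclideanSpace ℝ (Fin 2))} (hU : IsOpen U) (hne : U.Nonempty) :
    ∃ x ∈ U, ∀ i, x ∉ B i := by
  by_contra! h
  have h1 : U ⊆ ⋃ i, B i := fun x hx => Set.mem_iUnion.2 (h x hx)
  exact (hU.measure_pos volume hne).ne' (measure_mono_null h1 (measure_iUnion_null hB))

open MeasureTheory in
/-- The positions of an end point of a segment for which it passes through a given crossing. -/
theorem volume_concurrent_eq_zero {u a b c d : EuclideanSpace ℝ (Fin 2)} (h : orient a b c ≠ 0)
    (hu : orient a b u ≠ 0) :
    volume {x | (openSegment ℝ x u ∩ openSegment ℝ a b ∩ openSegment ℝ c d).Nonempty} = 0 := by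
  by_cases hz : ∃ z, z ∈ openSegment ℝ a b ∧ z ∈ openSegment ℝ c d
  · obtain ⟨z, hz1, hz2⟩ := hz
    have huz : u ≠ z := by
      rintro rfl
      exact hu (orient_eq_zero_of_mem_openSegment hz1)
    have hsub : {x | (openSegment ℝ x u ∩ openSegment ℝ a b ∩ openSegment ℝ c d).Nonempty} ⊆
        (line[ℝ, u, z] : Set (EuclideanSpace ℝ (Fin 2))) := by
      rintro x ⟨w, ⟨hw1, hw2⟩, hw3⟩
      obtain rfl := eq_of_mem_openSegment h hz1 hz2 hw2 hw3
      obtain ⟨s, t, hs, ht, hst, rfl⟩ := hw1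
      have : AffineMap.lineMap u (s • x + t • u) s⁻¹ = x := by
        obtain rfl : t = 1 - s := by linarith
        ext j
        simp [AffineMap.lineMap_apply]
        field_simp
        ring
      have hmem := AffineMap.lineMap_mem_affineSpan_pair s⁻¹ u (s • x + t • u)
      rwa [this] at hmem
    refine measure_mono_null hsub (Measure.addHaar_affineSubspace _ _ ?_)
    intro htop
    -- Adding to `u` the vector `z - u` turned by a right angle gives a point off the line, so the
    -- line is not the whole plane.
    have hcol : Collinear ℝ {u + !₂[-(z 1 - u 1), z 0 - u 0], u, z} :=
      collinear_insert_of_mem_affineSpan_pair (by rw [htop]; trivial)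
    have h0 := orient_eq_zero_of_collinear hcol
    simp [orient] at h0
    apply huz
    have h2 : (z 0 - u 0) * (z 0 - u 0) + (z 1 - u 1) * (z 1 - u 1) = 0 := by linarith
    ext j
    fin_cases j <;> simp <;> nlinarith [mul_self_nonneg (z 0 - u 0), mul_self_nonneg (z 1 - u 1)]
  · convert measure_empty (μ := volume)
    rw [Set.eq_empty_iff_forall_notMem]
    rintro x ⟨w, ⟨-, hw2⟩, hw3⟩
    exact hz ⟨w, hw2, hw3⟩

/-- No edge at `v` passes through the crossing of two edges when all six end points differ. -/
def NoTripleAt {V : Type*} (p : V → EuclideanSpace ℝ (Fin 2)) (v : V) : Prop :=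
  ∀ u a b c d, [v, u, a, b, c, d].Nodup →
    ¬ (openSegment ℝ (p v) (p u) ∩ openSegment ℝ (p a) (p b) ∩
      openSegment ℝ (p c) (p d)).Nonempty

/-- All triples of vertices have the same orientations in two general positions. -/
def SameOrient {V : Type*} (p q : V → EuclideanSpace ℝ (Fin 2)) : Prop :=
  ∀ a b c, a ≠ b → a ≠ c → b ≠ c →
    0 < orient (p a) (p b) (p c) * orient (q a) (q b) (q c)

theorem SameOrient.trans {V : Type*} {p q s : V → EuclideanSpace ℝ (Fin 2)}
    (h : SameOrient p q) (h' : SameOrient q s) : SameOrient p s := by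
  intro a b c hab hac hbc
  have h1 := h a b c hab hac hbc
  have h2 := h' a b c hab hac hbc
  rcases mul_pos_iff.1 h1 with ⟨x, y⟩ | ⟨x, y⟩ <;> rcases mul_pos_iff.1 h2 with ⟨z, w⟩ | ⟨z, w⟩
  · exact mul_pos x w
  · linarith
  · linarith
  · exact mul_pos_of_neg_of_neg x w

theorem exists_update_noTripleAt {V : Type*} [Finite V] [DecidableEq V]
    (p : V → EuclideanSpace ℝ (Fin 2)) (hp : SameOrient p p) (v : V) :
    ∃ x, SameOrient p (Function.update p v x) ∧ NoTripleAt (Function.update p v x) v := by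
  -- `U` consists of the positions of `v` that keep all orientations: finitely many strict
  -- inequalities, satisfied at `p v`. The sets `B` below are the positions that create a
  -- concurrency.
  let U : Set (EuclideanSpace ℝ (Fin 2)) := ⋂ t : V × V × V,
    {x | t.1 ≠ t.2.1 → t.1 ≠ t.2.2 → t.2.1 ≠ t.2.2 → 0 < orient (p t.1) (p t.2.1) (p t.2.2) *
      orient (Function.update p v x t.1) (Function.update p v x t.2.1)
        (Function.update p v x t.2.2)}
  have hU : IsOpen U := by
    refine isOpen_iInter_of_finite fun t => ?_
    by_cases h : t.1 ≠ t.2.1 ∧ t.1 ≠ t.2.2 ∧ t.2.1 ≠ t.2.2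
    · simp only [h.1, h.2.1, h.2.2, ne_eq, not_false_eq_true, forall_const]
      refine isOpen_lt continuous_const (continuous_const.mul ?_)
      have hc : ∀ w, Continuous fun x => Function.update p v x w := fun w => by
        have h : Continuous fun x => Function.update p v x :=
          continuous_const.update v continuous_id
        exact (continuous_apply w).comp h
      exact continuous_orient.comp ((hc _).prodMk ((hc _).prodMk (hc _)))
    · convert isOpen_univ
      ext x
      simp only [Set.mem_ofPred_eq, Set.mem_univ, iff_true]
      tauto
  have hne : U.Nonempty := ⟨p v, by
    simp only [U, Set.mem_iInter, Set.mem_ofPred_eq, Function.update_eq_self]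
    exact fun t => hp _ _ _⟩
  let B : V × V × V × V × V → Set (EuclideanSpace ℝ (Fin 2)) := fun t =>
    {x | [v, t.1, t.2.1, t.2.2.1, t.2.2.2.1, t.2.2.2.2].Nodup ∧
      (openSegment ℝ x (p t.1) ∩ openSegment ℝ (p t.2.1) (p t.2.2.1) ∩
        openSegment ℝ (p t.2.2.2.1) (p t.2.2.2.2)).Nonempty}
  have hB : ∀ t, MeasureTheory.volume (B t) = 0 := by
    rintro ⟨u, a, b, c, d⟩
    by_cases h : [v, u, a, b, c, d].Nodup
    · refine MeasureTheory.measure_mono_null (fun x hx => hx.2) (volume_concurrent_eq_zero ?_ ?_)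
      · simp only [List.nodup_cons, List.mem_cons, List.not_mem_nil, or_false, not_or] at h
        intro h0
        have := hp a b c (by tauto) (by tauto) (by tauto)
        rw [h0] at this; simp at this
      · simp only [List.nodup_cons, List.mem_cons, List.not_mem_nil, or_false, not_or] at h
        intro h0
        have := hp a b u (by tauto) (by tauto) (by tauto)
        rw [h0] at this; simp at this
    · convert MeasureTheory.measure_empty (μ := MeasureTheory.volume)
      ext x
      simp [B, -List.nodup_cons, h]
  obtain ⟨x, hxU, hxB⟩ := exists_mem_forall_notMem_of_null B hB hU hne
  refine ⟨x, fun a b c => Set.mem_iInter.1 hxU (a, b, c), fun u a b c d hnd hx => ?_⟩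
  refine hxB (u, a, b, c, d) ⟨hnd, ?_⟩
  simp only [List.nodup_cons, List.mem_cons, List.not_mem_nil, or_false, not_or] at hnd
  obtain ⟨⟨h1, h2, h3, h4, h5⟩, -⟩ := hnd
  rwa [Function.update_self, Function.update_of_ne (Ne.symm h1),
    Function.update_of_ne (Ne.symm h2), Function.update_of_ne (Ne.symm h3),
    Function.update_of_ne (Ne.symm h4), Function.update_of_ne (Ne.symm h5)] at hx

theorem SameOrient.refl_right {V : Type*} {p q : V → EuclideanSpace ℝ (Fin 2)}
    (h : SameOrient p q) : SameOrient q q := by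
  intro a b c hab hac hbc
  refine mul_self_pos.2 fun h0 => ?_
  have := h a b c hab hac hbc
  rw [h0] at this; simp at this

/-- Points in general position can be perturbed so that no three disjoint edges are concurrent. -/
theorem exists_sameOrient_noTriple {V : Type*} [Fintype V] (p : V → EuclideanSpace ℝ (Fin 2))
    (hp : SameOrient p p) : ∃ q, SameOrient p q ∧ ∀ v, NoTripleAt q v := by
  classical
  suffices h : ∀ T : Finset V, ∃ q, SameOrient p q ∧ ∀ v ∈ T, NoTripleAt q v by
    simpa using h Finset.univ
  intro T
  induction T using Finset.induction_on with
  | empty => exact ⟨p, hp, by simp⟩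
  | insert v T _ ih =>
    obtain ⟨q, hpq, hq⟩ := ih
    obtain ⟨x, hx, hx'⟩ := exists_update_noTripleAt q hpq.refl_right v
    refine ⟨_, hpq.trans hx, fun w hw => ?_⟩
    by_cases hwv : w = v
    · rwa [hwv]
    have hwT : w ∈ T := (Finset.mem_insert.1 hw).resolve_left hwv
    intro u a b c d hnd
    rintro ⟨z, ⟨hz1, hz2⟩, hz3⟩
    simp only [List.nodup_cons, List.mem_cons, List.not_mem_nil, or_false, not_or,
      not_false_eq_true, List.nodup_nil, and_true] at hnd
    have perm : ∀ u' a' b' c' d', ([v, u', a', b', c', d'] : List V).Nodup →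
        z ∈ openSegment ℝ (Function.update q v x v) (Function.update q v x u') →
        z ∈ openSegment ℝ (Function.update q v x a') (Function.update q v x b') →
        z ∈ openSegment ℝ (Function.update q v x c') (Function.update q v x d') → False :=
      fun u' a' b' c' d' h h1 h2 h3 => hx' u' a' b' c' d' h ⟨z, ⟨h1, h2⟩, h3⟩
    simp only [List.nodup_cons, List.mem_cons, List.not_mem_nil, or_false, not_or,
      not_false_eq_true, List.nodup_nil, and_true] at perm
    -- If `v` is one of the other five end points, the roles are permuted so that `v` comes first.
    -- Otherwise none of the six points has moved.
    by_cases hu : u = v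
    · subst hu
      exact perm w a b c d (by grind) (by rwa [openSegment_symm]) hz2 hz3
    by_cases ha : a = v
    · subst ha
      exact perm b w u c d (by grind) hz2 hz1 hz3
    by_cases hb : b = v
    · subst hb
      exact perm a w u c d (by grind) (by rwa [openSegment_symm]) hz1 hz3
    by_cases hc : c = v
    · subst hc
      exact perm d w u a b (by grind) hz3 hz1 hz2
    by_cases hd : d = v
    · subst hd
      exact perm c w u a b (by grind) (by rwa [openSegment_symm]) hz1 hz2
    rw [Function.update_of_ne hwv, Function.update_of_ne hu] at hz1
    rw [Function.update_of_ne ha, Function.update_of_ne hb] at hz2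
    rw [Function.update_of_ne hc, Function.update_of_ne hd] at hz3
    refine hq w hwT u a b c d ?_ ⟨z, ⟨hz1, hz2⟩, hz3⟩
    simp only [List.nodup_cons, List.mem_cons, List.not_mem_nil, or_false, not_or,
      not_false_eq_true, List.nodup_nil, and_true]
    exact hnd

/-! ### Pushed points on the parabola and their orientations -/

/-- The point of the standard parabola with abscissa `t`. -/
noncomputable def parabola (t : ℝ) : EuclideanSpace ℝ (Fin 2) := !₂[t, t ^ 2]

theorem orient_parabola (a b c : ℝ) :
    orient (parabola a) (parabola b) (parabola c) = (b - a) * (c - a) * (c - b) := by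
  simp [orient, parabola]; ring

/-- The limit index of the vertex `j`: the vertices in `S` move next to their successors. -/
def limitIndex (S : Finset ℕ) (j : ℕ) : ℕ := if j ∈ S then j + 1 else j

/-- A point of the parabola separating the `r` cyclic predecessors of `i` among
`0, …, n - 1` from the other vertices. -/
noncomputable def separator (n r i : ℕ) : ℝ :=
  if r ≤ i then (i : ℝ) - r - 1 / 2 else (n : ℝ) + i - r - 1 / 2

/-- Points on the parabola, those in `S` moved next to their successors. -/
noncomputable def pushed (S : Finset ℕ) (n r : ℕ) (ε : ℝ) (j : ℕ) : EuclideanSpace ℝ (Fin 2) :=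
  if j ∈ S then (1 - ε) • parabola (j + 1 : ℕ) + ε • parabola (separator n r j) else parabola j

/-- The triples `a < b < c` that `pushed` orients clockwise. -/
def Flipped (S : Finset ℕ) (n r a b c : ℕ) : Prop :=
  (c = b + 1 ∧ b ∈ S ∧ b ≤ a + r) ∨ (b = a + 1 ∧ a ∈ S ∧ n + a ≤ c + r)

/-- The orientations of the triples are those prescribed by `Flipped`. -/
def HasFlippedOrient (S : Finset ℕ) (n r : ℕ) (p : ℕ → EuclideanSpace ℝ (Fin 2)) : Prop :=
  ∀ a b c, a < b → b < c → c < n →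
    (Flipped S n r a b c → orient (p a) (p b) (p c) < 0) ∧
    (¬ Flipped S n r a b c → 0 < orient (p a) (p b) (p c))

theorem pushed_zero (S : Finset ℕ) (n r j : ℕ) :
    pushed S n r 0 j = parabola (limitIndex S j : ℕ) := by
  unfold pushed limitIndex
  split_ifs <;> simp

theorem continuous_pushed (S : Finset ℕ) (n r j : ℕ) :
    Continuous fun ε => pushed S n r ε j := by
  unfold pushed
  split_ifs <;> fun_prop

/-- No two elements of `S` differ by an element of `D`. -/
def AvoidsDiff (D S : Finset ℕ) : Prop := ∀ i ∈ S, ∀ d ∈ D, i + d ∉ S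

/-- At `ε = 0` this triple degenerates. Factoring out `ε` leaves an area with nonzero limit, from
which the sign for small positive `ε` can be read. -/
theorem orient_pushed_succ {S : Finset ℕ} {n r i : ℕ} (hi : i ∈ S) (hi' : i + 1 ∉ S) (ε : ℝ)
    (x : EuclideanSpace ℝ (Fin 2)) :
    orient (pushed S n r ε i) (pushed S n r ε (i + 1)) x =
      ε * orient (parabola (separator n r i)) (parabola (i + 1 : ℕ)) x := by
  rw [pushed, if_pos hi, pushed, if_neg hi']
  simp only [orient, PiLp.add_apply, PiLp.smul_apply, smul_eq_mul]
  ring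

open Filter Topology in
theorem eventually_pos_of_continuous {f : ℝ → ℝ} (hf : Continuous f) (h : 0 < f 0) :
    ∀ᶠ ε in 𝓝[>] (0 : ℝ), 0 < f ε :=
  (hf.continuousAt.eventually (lt_mem_nhds h)).filter_mono nhdsWithin_le_nhds

open Filter Topology in
theorem eventually_neg_of_continuous {f : ℝ → ℝ} (hf : Continuous f) (h : f 0 < 0) :
    ∀ᶠ ε in 𝓝[>] (0 : ℝ), f ε < 0 :=
  (hf.continuousAt.eventually (gt_mem_nhds h)).filter_mono nhdsWithin_le_nhds

theorem continuous_orient_comp {f g h : ℝ → EuclideanSpace ℝ (Fin 2)} (hf : Continuous f)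
    (hg : Continuous g) (hh : Continuous h) : Continuous fun t => orient (f t) (g t) (h t) :=
  continuous_orient.comp (hf.prodMk (hg.prodMk hh))

/-- The limit direction of a moved vertex `i` as seen from `i + 1`, compared with a vertex `c`. -/
theorem orient_separator {S : Finset ℕ} {n r i c : ℕ} (hr : r + 2 ≤ n)
    (h1 : AvoidsDiff {1, r + 1, n - r - 1} S) (hi : i ∈ S) (hc : c ≠ i) (hc' : c ≠ i + 1)
    (hcn : c < n) :
    (((c < i ∧ i ≤ c + r) ∨ (i + 1 < c ∧ n + i ≤ c + r)) →
      orient (parabola (separator n r i)) (parabola (i + 1 : ℕ))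
        (parabola (limitIndex S c : ℕ)) < 0) ∧
    (¬ ((c < i ∧ i ≤ c + r) ∨ (i + 1 < c ∧ n + i ≤ c + r)) →
      0 < orient (parabola (separator n r i)) (parabola (i + 1 : ℕ))
        (parabola (limitIndex S c : ℕ))) := by
  have e1 : c = i - 1 → i = 0 ∨ c ∉ S := by
    intro h
    by_contra! h'
    refine h1 c h'.2 1 (by simp) ?_
    rwa [show c + 1 = i by omega]
  -- A pushed `c` tends to `c + 1`. The vertex just before the `r` predecessors would thus jump over
  -- the separator; this is why the differences `r + 1` and, after wrapping around, `n - r - 1` are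
  -- forbidden.
  have e2 : c + r + 1 = i → c ∉ S := by
    intro h h'
    refine h1 c h' (r + 1) (by simp) ?_
    rwa [show c + (r + 1) = i by omega]
  have e3 : c + r + 1 = n + i → c ∉ S := by
    intro h h'
    refine h1 i hi (n - r - 1) (by simp) ?_
    rwa [show i + (n - r - 1) = c by omega]
  rw [orient_parabola]
  obtain ⟨l, hl⟩ : ∃ l, l = limitIndex S c := ⟨_, rfl⟩
  rw [← hl]
  have hl' : (l = c ∧ c ∉ S) ∨ (l = c + 1 ∧ c ∈ S) := by
    rw [hl, limitIndex]; split_ifs <;> simp_all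
  clear hl
  have hN : ∀ {x y : ℕ}, x ≤ y → (x : ℝ) ≤ y := fun h => by exact_mod_cast h
  rcases Nat.lt_or_ge c i with hci | hci
  · have a1 : l ≤ i := by rcases hl' with h | h <;> omega
    have b1 := hN a1
    rcases Nat.lt_or_ge i r with hri | hri
    -- The `r` predecessors wrap around here, so they include every `c < i`.
    · have b2 := hN (show r + 2 ≤ n from hr)
      push_cast at b2
      rw [separator, if_neg (by omega)]
      refine ⟨fun _ => ?_, fun h => absurd (Or.inl ⟨hci, by omega⟩) h⟩
      refine mul_neg_of_pos_of_neg (mul_pos_of_neg_of_neg ?_ ?_) ?_ <;> push_cast <;> linarith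
    · rw [separator, if_pos hri]
      refine ⟨fun h => ?_, fun h => ?_⟩
      · have a2 : i ≤ l + r := by rcases hl' with h | h <;> omega
        have b2 := hN a2
        push_cast at b2
        refine mul_neg_of_pos_of_neg (mul_pos ?_ ?_) ?_ <;> push_cast <;> linarith
      · have a2 : l + r + 1 ≤ i := by
          rcases hl' with h' | h'
          · omega
          · have : c + r + 1 ≠ i := fun h => e2 h h'.2
            omega
        have b2 := hN a2
        push_cast at b2
        refine mul_pos_of_neg_of_neg (mul_neg_of_pos_of_neg ?_ ?_) ?_ <;> push_cast <;> linarith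
  · have a1 : i + 2 ≤ l := by rcases hl' with h | h <;> omega
    have b1 := hN a1
    push_cast at b1
    rcases Nat.lt_or_ge i r with hri | hri
    · have b2 := hN (show r + 2 ≤ n from hr)
      push_cast at b2
      rw [separator, if_neg (by omega)]
      refine ⟨fun h => ?_, fun h => ?_⟩
      · have a2 : n + i ≤ l + r := by rcases hl' with h | h <;> omega
        have b2 := hN a2
        push_cast at b2
        refine mul_neg_of_neg_of_pos (mul_neg_of_neg_of_pos ?_ ?_) ?_ <;> push_cast <;> linarith
      · have a2 : l + r + 1 ≤ n + i := by
          rcases hl' with h' | h'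
          · omega
          · have : c + r + 1 ≠ n + i := fun h => e3 h h'.2
            omega
        have b2 := hN a2
        push_cast at b2
        refine mul_pos (mul_pos_of_neg_of_neg ?_ ?_) ?_ <;> push_cast <;> linarith
    · rw [separator, if_pos hri]
      refine ⟨fun h => by omega, fun _ => ?_⟩
      refine mul_pos (mul_pos ?_ ?_) ?_ <;> push_cast <;> linarith [(Nat.cast_nonneg r : (0:ℝ) ≤ r)]

-- A triple containing a pushed vertex and its successor gets its sign from the limit direction. In
-- any other triple the limit indices stay strictly increasing, so the orientation is already
-- positive at `ε = 0`.
open Filter Topology in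
theorem eventually_orient_pushed {S : Finset ℕ} {n r : ℕ} (hr : r + 2 ≤ n)
    (h1 : AvoidsDiff {1, r + 1, n - r - 1} S) {a b c : ℕ} (hab : a < b)
    (hbc : b < c) (hc : c < n) : ∀ᶠ ε in 𝓝[>] (0 : ℝ),
    (Flipped S n r a b c →
      orient (pushed S n r ε a) (pushed S n r ε b) (pushed S n r ε c) < 0) ∧
    (¬ Flipped S n r a b c →
      0 < orient (pushed S n r ε a) (pushed S n r ε b) (pushed S n r ε c)) := by
  have hpos : ∀ᶠ ε in 𝓝[>] (0 : ℝ), 0 < ε := self_mem_nhdsWithin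
  have hsucc : ∀ i ∈ S, i + 1 ∉ S := fun i hi => h1 i hi 1 (by simp)
  have key : ∀ i ∈ S, ∀ x, x ≠ i → x ≠ i + 1 → x < n → ∀ᶠ ε in 𝓝[>] (0 : ℝ),
      (((x < i ∧ i ≤ x + r) ∨ (i + 1 < x ∧ n + i ≤ x + r)) →
        orient (pushed S n r ε i) (pushed S n r ε (i + 1)) (pushed S n r ε x) < 0) ∧
      (¬ ((x < i ∧ i ≤ x + r) ∨ (i + 1 < x ∧ n + i ≤ x + r)) →
        0 < orient (pushed S n r ε i) (pushed S n r ε (i + 1)) (pushed S n r ε x)) := by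
    intro i hi x hxi hxi' hxn
    have hsep := orient_separator hr h1 hi hxi hxi' hxn
    have hcont : Continuous fun ε => orient (parabola (separator n r i)) (parabola (i + 1 : ℕ))
        (pushed S n r ε x) :=
      continuous_orient_comp continuous_const continuous_const (continuous_pushed S n r x)
    rw [← pushed_zero S n r x] at hsep
    by_cases hf : (x < i ∧ i ≤ x + r) ∨ (i + 1 < x ∧ n + i ≤ x + r)
    · filter_upwards [hpos, eventually_neg_of_continuous hcont (hsep.1 hf)] with ε h0 h2
      refine ⟨fun _ => ?_, fun h => absurd hf h⟩
      rw [orient_pushed_succ hi (hsucc i hi)]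
      exact mul_neg_of_pos_of_neg h0 h2
    · filter_upwards [hpos, eventually_pos_of_continuous hcont (hsep.2 hf)] with ε h0 h2
      refine ⟨fun h => absurd h hf, fun _ => ?_⟩
      rw [orient_pushed_succ hi (hsucc i hi)]
      exact mul_pos h0 h2
  by_cases hA : b = a + 1 ∧ a ∈ S
  · obtain ⟨rfl, haS⟩ := hA
    have hfl : Flipped S n r a (a + 1) c ↔
        ((c < a ∧ a ≤ c + r) ∨ (a + 1 < c ∧ n + a ≤ c + r)) := by
      have := hsucc a haS
      unfold Flipped
      constructor
      · rintro (h | h)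
        · exact absurd h.2.1 this
        · exact Or.inr ⟨hbc, h.2.2⟩
      · rintro (h | h)
        · omega
        · exact Or.inr ⟨rfl, haS, h.2⟩
    rw [hfl]
    exact key a haS c (by omega) (by omega) hc
  by_cases hB : c = b + 1 ∧ b ∈ S
  · obtain ⟨rfl, hbS⟩ := hB
    have hfl : Flipped S n r a b (b + 1) ↔
        ((a < b ∧ b ≤ a + r) ∨ (b + 1 < a ∧ n + b ≤ a + r)) := by
      unfold Flipped
      constructor
      · rintro (h | h)
        · exact Or.inl ⟨hab, h.2.2⟩
        · exact absurd ⟨h.1, h.2.1⟩ hA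
      · rintro (h | h)
        · exact Or.inl ⟨rfl, hbS, h.2⟩
        · omega
    rw [hfl]
    filter_upwards [key b hbS a (by omega) (by omega) (by omega)] with ε h
    rwa [← orient_rotate]
  have hnf : ¬ Flipped S n r a b c := by
    rintro (h | h)
    · exact hB ⟨h.1, h.2.1⟩
    · exact hA ⟨h.1, h.2.1⟩
  have h0 : 0 < orient (pushed S n r 0 a) (pushed S n r 0 b) (pushed S n r 0 c) := by
    rw [pushed_zero, pushed_zero, pushed_zero, orient_parabola]
    have l1 : limitIndex S a < limitIndex S b := by
      unfold limitIndex
      split_ifs with h h' h'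
      · omega
      · have : b ≠ a + 1 := fun e => hA ⟨e, h⟩
        omega
      · omega
      · omega
    have l2 : limitIndex S b < limitIndex S c := by
      unfold limitIndex
      split_ifs with h h' h'
      · omega
      · have : c ≠ b + 1 := fun e => hB ⟨e, h⟩
        omega
      · omega
      · omega
    have l1' : (limitIndex S a : ℝ) < limitIndex S b := by exact_mod_cast l1
    have l2' : (limitIndex S b : ℝ) < limitIndex S c := by exact_mod_cast l2
    refine mul_pos (mul_pos ?_ ?_) ?_ <;> linarith
  filter_upwards [eventually_pos_of_continuous (continuous_orient_comp (continuous_pushed S n r a)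
    (continuous_pushed S n r b) (continuous_pushed S n r c)) h0] with ε h
  exact ⟨fun h' => absurd h' hnf, fun _ => h⟩

open Filter Topology in
theorem exists_hasFlippedOrient {S : Finset ℕ} {n r : ℕ} (hr : r + 2 ≤ n)
    (h1 : AvoidsDiff {1, r + 1, n - r - 1} S) :
    ∃ p, HasFlippedOrient S n r p := by
  have h : ∀ᶠ ε in 𝓝[>] (0 : ℝ), ∀ a ∈ Finset.range n, ∀ b ∈ Finset.range n,
      ∀ c ∈ Finset.range n, a < b → b < c →
      (Flipped S n r a b c →
        orient (pushed S n r ε a) (pushed S n r ε b) (pushed S n r ε c) < 0) ∧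
      (¬ Flipped S n r a b c →
        0 < orient (pushed S n r ε a) (pushed S n r ε b) (pushed S n r ε c)) := by
    simp only [eventually_all_finset]
    intro a _ b _ c hc
    by_cases hab : a < b
    · by_cases hbc : b < c
      · filter_upwards [eventually_orient_pushed hr h1 hab hbc (Finset.mem_range.1 hc)] with ε h
        exact fun _ _ => h
      · exact Eventually.of_forall fun _ _ h => absurd h hbc
    · exact Eventually.of_forall fun _ h => absurd h hab
  obtain ⟨ε, hε⟩ := h.exists
  exact ⟨pushed S n r ε, fun a b c hab hbc hc => hε a (Finset.mem_range.2 (by omega)) b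
    (Finset.mem_range.2 (by omega)) c (Finset.mem_range.2 hc) hab hbc⟩

/-! ### Sets avoiding given differences -/

/-- A large subset of an interval without two elements at one of few given distances. -/
theorem exists_avoidsDiff (D : Finset ℕ) (N : ℕ) :
    ∃ S ⊆ Finset.range N, AvoidsDiff (D.erase 0) S ∧ N ≤ S.card * (2 * D.card + 1) := by
  classical
  obtain ⟨S, hS, hmax⟩ := Finset.exists_max_image
    ((Finset.range N).powerset.filter (AvoidsDiff (D.erase 0))) Finset.card
    ⟨∅, by simp [AvoidsDiff]⟩
  simp only [Finset.mem_filter, Finset.mem_powerset] at hS hmax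
  refine ⟨S, hS.1, hS.2, ?_⟩
  -- By maximality every `x` lies in `S` or at a distance in `D` from an element of `S`; each
  -- element accounts for at most `2 * D.card + 1` values.
  have hcover : Finset.range N ⊆ S.biUnion fun s =>
      insert s (D.image (fun d => s + d) ∪ D.image (fun d => s - d)) := by
    intro x hx
    by_contra hx'
    simp only [Finset.mem_biUnion, Finset.mem_insert, Finset.mem_union, Finset.mem_image,
      not_exists, not_and, not_or] at hx'
    have hxS : x ∉ S := fun h => (hx' x h).1 rfl
    have := hmax (insert x S) ⟨Finset.insert_subset hx hS.1, ?_⟩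
    · rw [Finset.card_insert_of_notMem hxS] at this
      omega
    · intro i hi d hd hid
      rw [Finset.mem_erase] at hd
      rcases Finset.mem_insert.1 hi with rfl | hi'
      · rcases Finset.mem_insert.1 hid with h | h
        · omega
        · exact (hx' _ h).2.2 d hd.2 (by omega)
      · rcases Finset.mem_insert.1 hid with h | h
        · exact (hx' _ hi').2.1 d hd.2 h
        · exact hS.2 i hi' d (Finset.mem_erase.2 hd) h
  have h := Finset.card_le_card hcover
  rw [Finset.card_range] at h
  refine h.trans (Finset.card_biUnion_le_card_mul _ _ _ fun s _ => ?_)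
  have h1 : (D.image (fun d => s + d)).card ≤ D.card := Finset.card_image_le
  have h2 : (D.image (fun d => s - d)).card ≤ D.card := Finset.card_image_le
  have h3 := Finset.card_union_le (D.image (fun d => s + d)) (D.image (fun d => s - d))
  have h4 := Finset.card_insert_le s (D.image (fun d => s + d) ∪ D.image (fun d => s - d))
  omega

/-! ### Crossings on a chord from a pushed vertex -/

/-- The pairs of vertices, one on each side of the chord from `i` to `i + m`, such that the segment
between them crosses that chord. -/
def crossingPairs (n m r i : ℕ) : Finset (ℕ × ℕ) :=
  Finset.Ioo i (i + m) ×ˢ (Finset.range i ∪ Finset.Ioo (i + m) n) \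
    {i + 1} ×ˢ (Finset.Ico (i - r) i ∪ Finset.Ico (n + i - r) n)

theorem mem_crossingPairs {n m r i a b : ℕ} : (a, b) ∈ crossingPairs n m r i ↔
    ((i < a ∧ a < i + m) ∧ (b < i ∨ (i + m < b ∧ b < n))) ∧
      ¬ (a = i + 1 ∧ ((i ≤ b + r ∧ b < i) ∨ (n + i ≤ b + r ∧ b < n))) := by
  simp only [crossingPairs, Finset.mem_sdiff, Finset.mem_product, Finset.mem_Ioo, Finset.mem_union,
    Finset.mem_range, Finset.mem_singleton, Finset.mem_Ico]
  omega

/-- All `r` removed pairs were present: `m + r < n` keeps the predecessors of `i` outside the chord,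
and `i + 1` is strictly inside unless `m = 1`, when `r = 0`. -/
theorem card_crossingPairs {n m r i : ℕ} (hm : 1 ≤ m) (hmr : m + r < n) (hr : m = 1 → r = 0)
    (hi : i + m < n) : (crossingPairs n m r i).card = (m - 1) * (n - 1 - m) - r := by
  have hY : (Finset.Ico (i - r) i ∪ Finset.Ico (n + i - r) n).card = r := by
    rw [Finset.card_union_of_disjoint, Nat.card_Ico, Nat.card_Ico]
    · omega
    · rw [Finset.disjoint_left]
      intro x
      simp only [Finset.mem_Ico]
      omega
  have hO : (Finset.range i ∪ Finset.Ioo (i + m) n).card = n - 1 - m := by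
    rw [Finset.card_union_of_disjoint, Finset.card_range, Nat.card_Ioo]
    · omega
    · rw [Finset.disjoint_left]
      intro x
      simp only [Finset.mem_range, Finset.mem_Ioo]
      omega
  rw [crossingPairs, Finset.card_sdiff_of_subset, Finset.card_product, Finset.card_product,
    Finset.card_singleton, hY, hO, Nat.card_Ioo, one_mul]
  · congr 2
    omega
  · rintro ⟨a, b⟩
    simp only [Finset.mem_product, Finset.mem_Ioo, Finset.mem_union,
      Finset.mem_range, Finset.mem_singleton, Finset.mem_Ico]
    omega

section chord

variable {S : Finset ℕ} {n m r i : ℕ} {p : ℕ → EuclideanSpace ℝ (Fin 2)}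

theorem HasFlippedOrient.ne_zero (h : HasFlippedOrient S n r p) {a b c : ℕ} (ha : a < n)
    (hb : b < n) (hc : c < n) (hab : a ≠ b) (hac : a ≠ c) (hbc : b ≠ c) :
    orient (p a) (p b) (p c) ≠ 0 := by
  have key : ∀ a b c, a < b → b < c → c < n → orient (p a) (p b) (p c) ≠ 0 := by
    intro a b c hab hbc hc
    by_cases hf : Flipped S n r a b c
    · exact ((h a b c hab hbc hc).1 hf).ne
    · exact ((h a b c hab hbc hc).2 hf).ne'
  rcases lt_or_gt_of_ne hab with h1 | h1 <;> rcases lt_or_gt_of_ne hac with h2 | h2 <;>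
    rcases lt_or_gt_of_ne hbc with h3 | h3
  · exact key a b c h1 h3 hc
  · rw [← neg_ne_zero, ← orient_swap_right]
    exact key a c b h2 h3 hb
  · omega
  · rw [orient_rotate]
    exact key c a b h2 h1 hb
  · rw [← neg_ne_zero, ← orient_swap]
    exact key b a c h1 h2 hc
  · omega
  · rw [← orient_rotate]
    exact key b c a h3 h2 ha
  · rw [← orient_rotate, ← neg_ne_zero, ← orient_swap]
    exact key c b a h3 h1 ha

/-- The chord from `i` to `i + m` starts at a moved vertex, and no other move affects it. -/
structure IsChord (S : Finset ℕ) (n m r i : ℕ) : Prop where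
  one_le : 1 ≤ m
  add_lt : m + r < n
  eq_zero : m = 1 → r = 0
  end_lt : i + m < n
  start_mem : i ∈ S
  succ_ne : ∀ j ∈ S, j + 1 ≠ i
  end_notMem : i + m ∉ S
  succ_ne_end : 2 ≤ m → ∀ j ∈ S, j + 1 ≠ i + m

/-- No push reverses a triple containing both ends of the chord, so its two sides are those of
convex position, here and in `orient_inside`. -/
theorem orient_outside (h : HasFlippedOrient S n r p) (hi : IsChord S n m r i) {x : ℕ}
    (hx : x < i ∨ (i + m < x ∧ x < n)) : 0 < orient (p i) (p (i + m)) (p x) := by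
  obtain ⟨h1, h2, h3, h4, h5, h6, h7, h8⟩ := hi
  rcases hx with hx | ⟨hx, hxn⟩
  · rw [orient_rotate]
    refine (h x i (i + m) hx (by omega) h4).2 ?_
    rintro (⟨ha, -, hb⟩ | ⟨ha, hb, -⟩)
    · omega
    · exact h6 x hb ha.symm
  · refine (h i (i + m) x (by omega) hx hxn).2 ?_
    rintro (⟨-, ha, -⟩ | ⟨ha, -, hb⟩)
    · exact h7 ha
    · omega

theorem orient_inside (h : HasFlippedOrient S n r p) (hi : IsChord S n m r i) {x : ℕ}
    (hx : i < x) (hx' : x < i + m) : orient (p i) (p (i + m)) (p x) < 0 := by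
  obtain ⟨h1, h2, h3, h4, h5, h6, h7, h8⟩ := hi
  rw [orient_swap_right, neg_lt_zero]
  refine (h i x (i + m) hx hx' h4).2 ?_
  rintro (⟨ha, hb, -⟩ | ⟨ha, -, hb⟩)
  · exact h8 (by omega) x hb ha.symm
  · omega

/-- Neither the far end nor its predecessor is pushed, so the sign is that of convex position.
Whether `a b` crosses the chord then depends only on the side of `i`. -/
theorem orient_end (h : HasFlippedOrient S n r p) (hi : IsChord S n m r i) {a b : ℕ}
    (ha : i < a) (ha' : a < i + m) (hb : b < i ∨ (i + m < b ∧ b < n)) :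
    orient (p a) (p b) (p (i + m)) < 0 := by
  obtain ⟨h1, h2, h3, h4, h5, h6, h7, h8⟩ := hi
  rcases hb with hb | ⟨hb, hbn⟩
  · rw [orient_swap, neg_lt_zero]
    refine (h b a (i + m) (by omega) ha' h4).2 ?_
    rintro (⟨h, h', -⟩ | ⟨h, h', -⟩)
    · exact h8 (by omega) a h' h.symm
    · omega
  · rw [orient_swap_right, neg_lt_zero]
    refine (h a (i + m) b ha' hb hbn).2 ?_
    rintro (⟨-, h', -⟩ | ⟨h, h', -⟩)
    · exact h7 h'
    · exact h8 (by omega) a h' h.symm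

/-- Here the push takes effect: the sign differs from convex position exactly when `a = i + 1` and
`b` is one of the `r` cyclic predecessors of `i`. -/
theorem orient_start (h : HasFlippedOrient S n r p) (hi : IsChord S n m r i) {a b : ℕ}
    (ha : i < a) (ha' : a < i + m) (hb : b < i ∨ (i + m < b ∧ b < n)) :
    (0 < orient (p a) (p b) (p i) ↔ (a, b) ∈ crossingPairs n m r i) := by
  obtain ⟨h1, h2, h3, h4, h5, h6, h7, h8⟩ := hi
  have key : ∀ {P Q : Prop} {t : ℝ}, (P → t < 0) ∧ (¬ P → 0 < t) → (Q ↔ ¬ P) → (0 < t ↔ Q) := by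
    intro P Q t hP hQ
    rw [hQ]
    exact ⟨fun ht hP' => lt_asymm ht (hP.1 hP'), hP.2⟩
  rw [mem_crossingPairs]
  rcases hb with hb | ⟨hb, hbn⟩
  · rw [← orient_rotate]
    refine key (h b i a hb ha (by omega)) ?_
    have : b + 1 = i → b ∉ S := fun h h' => h6 b h' h
    unfold Flipped
    constructor
    · rintro ⟨-, h⟩ (⟨e1, -, e2⟩ | ⟨e1, e2, -⟩)
      · omega
      · exact this e1.symm e2
    · intro hf
      refine ⟨by omega, fun hg => hf (Or.inl ⟨hg.1, h5, by omega⟩)⟩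
  · rw [orient_rotate]
    refine key (h i a b ha (by omega) hbn) ?_
    unfold Flipped
    constructor
    · rintro ⟨-, h⟩ (⟨e1, -, e2⟩ | ⟨e1, -, e2⟩)
      · omega
      · omega
    · intro hf
      refine ⟨by omega, fun hg => hf (Or.inr ⟨hg.1, h5, by omega⟩)⟩

/-- A segment from inside to outside meets the chord exactly if it is one of the crossing pairs. -/
theorem exists_mem_iff_mem_crossingPairs (h : HasFlippedOrient S n r p) (hi : IsChord S n m r i)
    {a b : ℕ} (ha : i < a) (ha' : a < i + m) (hb : b < i ∨ (i + m < b ∧ b < n)) :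
    (∃ z, z ∈ openSegment ℝ (p i) (p (i + m)) ∧ z ∈ openSegment ℝ (p a) (p b)) ↔
      (a, b) ∈ crossingPairs n m r i := by
  have hend := orient_end h hi ha ha' hb
  have hlt := hi.end_lt
  rw [← orient_start h hi ha ha' hb]
  constructor
  · rintro ⟨z, hz1, hz2⟩
    have h0 : orient (p a) (p b) (p i) ≠ 0 :=
      h.ne_zero (by omega) (by omega) (by omega) (by omega) (by omega) (by omega)
    exact (pos_iff_neg_of_mul_neg (orient_mul_orient_neg hz2 hz1 h0)).2 hend
  · intro h0
    exact exists_mem_openSegment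
      (mul_neg_of_neg_of_pos (orient_inside h hi ha ha') (orient_outside h hi hb))
      (mul_neg_of_pos_of_neg h0 hend)

/-- An edge that meets the chord joins an inside vertex to an outside vertex. -/
theorem sides_of_mem (h : HasFlippedOrient S n r p) (hi : IsChord S n m r i) {u v : ℕ}
    (hu : u < n) (hv : v < n) (huv : u ≠ v) (hne : s(u, v) ≠ s(i, i + m))
    {z : EuclideanSpace ℝ (Fin 2)}
    (hz : z ∈ openSegment ℝ (p i) (p (i + m))) (hz' : z ∈ openSegment ℝ (p u) (p v)) :
    ((i < u ∧ u < i + m) ∧ (v < i ∨ (i + m < v ∧ v < n))) ∨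
      ((i < v ∧ v < i + m) ∧ (u < i ∨ (i + m < u ∧ u < n))) := by
  have hlt := hi.end_lt
  have hm := hi.one_le
  have hne1 : ¬ (u = i ∧ v = i + m) := fun h => hne (by rw [h.1, h.2])
  have hne2 : ¬ (v = i ∧ u = i + m) := fun h => hne (by rw [h.1, h.2, Sym2.eq_swap])
  have share : ∀ x y w, x < n → y < n → w < n → x ≠ y → x ≠ w → y ≠ w →
      z ∈ openSegment ℝ (p x) (p y) → z ∉ openSegment ℝ (p x) (p w) :=
    fun x y w hx hy hw hxy hxw hyw =>
      not_mem_openSegment_of_common_endpoint (h.ne_zero hx hy hw hxy hxw hyw)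
  have hz2 : z ∈ openSegment ℝ (p (i + m)) (p i) := by rwa [openSegment_symm]
  have hz2' : z ∈ openSegment ℝ (p v) (p u) := by rwa [openSegment_symm]
  by_cases e1 : u = i
  · subst e1
    exact absurd hz' (share _ _ _ hu hlt hv (by omega) huv (by omega) hz)
  by_cases e2 : v = i
  · subst e2
    exact absurd hz2' (share _ _ _ hv hlt hu (by omega) huv.symm (by omega) hz)
  by_cases e3 : u = i + m
  · subst e3
    exact absurd hz' (share _ _ _ hu (by omega) hv (by omega) huv (by omega) hz2)
  by_cases e4 : v = i + m
  · subst e4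
    exact absurd hz2' (share _ _ _ hv (by omega) hu (by omega) huv.symm (by omega) hz2)
  have hneg := orient_mul_orient_neg hz hz'
    (h.ne_zero (by omega) hlt hu (by omega) (Ne.symm e1) (Ne.symm e3))
  have side : ∀ x, x < n → x ≠ i → x ≠ i + m →
      ((i < x ∧ x < i + m) ∧ orient (p i) (p (i + m)) (p x) < 0) ∨
      ((x < i ∨ (i + m < x ∧ x < n)) ∧ 0 < orient (p i) (p (i + m)) (p x)) := by
    intro x hx h1 h2
    by_cases hin : i < x ∧ x < i + m
    · exact Or.inl ⟨hin, orient_inside h hi hin.1 hin.2⟩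
    · have hout : x < i ∨ (i + m < x ∧ x < n) := by omega
      exact Or.inr ⟨hout, orient_outside h hi hout⟩
  rcases side u hu e1 e3 with ⟨hs, ho⟩ | ⟨hs, ho⟩ <;>
    rcases side v hv e2 e4 with ⟨hs', ho'⟩ | ⟨hs', ho'⟩
  · exact absurd hneg (not_lt.2 (mul_pos_of_neg_of_neg ho ho').le)
  · exact Or.inl ⟨hs, hs'⟩
  · exact Or.inr ⟨hs', hs⟩
  · exact absurd hneg (not_lt.2 (mul_pos ho ho').le)

end chord

theorem edgeInterior_mk {V : Type*} (p : V → EuclideanSpace ℝ (Fin 2)) (a b : V) :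
    edgeInterior p s(a, b) = openSegment ℝ (p a) (p b) := rfl

/-- The number of crossings on a chord starting at a moved vertex. -/
theorem encard_crossingsOn {S : Finset ℕ} {n m r i : ℕ} {p : ℕ → EuclideanSpace ℝ (Fin 2)}
    (D : RectilinearDrawing (⊤ : SimpleGraph (Fin n))) (hD : ∀ v : Fin n, D.pos v = p v)
    (h : HasFlippedOrient S n r p) (hi : IsChord S n m r i) (hin : i < n) :
    (D.crossingsOn s(⟨i, hin⟩, ⟨i + m, hi.end_lt⟩)).encard = (crossingPairs n m r i).card := by
  have hm := hi.one_le
  have hlt := hi.end_lt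
  have hX : ∀ t ∈ crossingPairs n m r i, ∃ z, z ∈ openSegment ℝ (p i) (p (i + m)) ∧
      z ∈ openSegment ℝ (p t.1) (p t.2) := by
    rintro ⟨a, b⟩ ht
    have ht' := (mem_crossingPairs.1 ht).1
    exact (exists_mem_iff_mem_crossingPairs h hi ht'.1.1 ht'.1.2 ht'.2).2 ht
  choose! X hX1 hX2 using hX
  have hinj : Set.InjOn X (crossingPairs n m r i : Set (ℕ × ℕ)) := by
    rintro ⟨a, b⟩ ht ⟨a', b'⟩ ht' hXX
    by_contra hne
    rw [Finset.mem_coe] at ht ht'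
    have h1 := (mem_crossingPairs.1 ht).1
    have h2 := (mem_crossingPairs.1 ht').1
    have hne' : ¬ (a = a' ∧ b = b') := fun h => hne (by rw [h.1, h.2])
    -- Two pairs with the same crossing point would make three edges concurrent.
    have htriple := D.noTriplePoint s(⟨i, hin⟩, ⟨i + m, hlt⟩) (by simp; omega)
      s(⟨a, by omega⟩, ⟨b, by omega⟩) (by simp; omega)
      s(⟨a', by omega⟩, ⟨b', by omega⟩) (by simp; omega)
      (by simp; omega) (by simp; omega) (by simp; omega)
    simp only [edgeInterior_mk, hD] at htriple
    have hmem : X (a, b) ∈ (∅ : Set (EuclideanSpace ℝ (Fin 2))) := by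
      rw [← htriple]
      exact ⟨⟨hX1 _ ht, hX2 _ ht⟩, by rw [hXX]; exact hX2 _ ht'⟩
    exact hmem
  have himage : D.crossingsOn s(⟨i, hin⟩, ⟨i + m, hlt⟩) =
      X '' (crossingPairs n m r i : Set (ℕ × ℕ)) := by
    ext z
    simp only [RectilinearDrawing.crossingsOn, Set.mem_ofPred_eq, edgeInterior_mk, hD]
    constructor
    · rintro ⟨hz, f, hf, hfe, hzf⟩
      induction f using Sym2.ind with
      | _ u v =>
      rw [edgeInterior_mk, hD, hD] at hzf
      have huv : u ≠ v := by simpa using hf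
      have main : ∀ u v : Fin n, z ∈ openSegment ℝ (p u) (p v) →
          ((i < (u : ℕ) ∧ (u : ℕ) < i + m) ∧ ((v : ℕ) < i ∨ (i + m < (v : ℕ) ∧ (v : ℕ) < n))) →
          z ∈ X '' (crossingPairs n m r i : Set (ℕ × ℕ)) := by
        intro u v hzf hs
        have hmem := (exists_mem_iff_mem_crossingPairs h hi hs.1.1 hs.1.2 hs.2).1 ⟨z, hz, hzf⟩
        refine ⟨_, hmem, ?_⟩
        exact eq_of_mem_openSegment (h.ne_zero hin hlt u.2 (by omega) (by omega) (by omega))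
          (hX1 _ hmem) (hX2 _ hmem) hz hzf
      have hne : s((u : ℕ), (v : ℕ)) ≠ s(i, i + m) := by
        intro he
        apply hfe
        rw [Sym2.eq_iff] at he ⊢
        simpa [Fin.ext_iff] using he
      rcases sides_of_mem h hi u.2 v.2 (by simpa [Fin.ext_iff] using huv) hne hz hzf with hs | hs
      · exact main u v hzf hs
      · exact main v u (by rwa [openSegment_symm]) hs
    · rintro ⟨⟨a, b⟩, ht, rfl⟩
      rw [Finset.mem_coe] at ht
      have h1 := (mem_crossingPairs.1 ht).1
      refine ⟨hX1 _ ht, s(⟨a, by omega⟩, ⟨b, by omega⟩), by simp; omega, by simp; omega, ?_⟩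
      simp only [edgeInterior_mk, hD]
      exact hX2 _ ht
  rw [himage, hinj.encard_image, Set.encard_coe_eq_coe_finsetCard]

/-! ### From orientations to drawings -/

/-- Points in general position without concurrent disjoint edges give a drawing. -/
theorem exists_rectilinearDrawing {V : Type*} (q : V → EuclideanSpace ℝ (Fin 2))
    (hinj : Function.Injective q)
    (hq : ∀ a b c, a ≠ b → a ≠ c → b ≠ c → orient (q a) (q b) (q c) ≠ 0)
    (hq' : ∀ v, NoTripleAt q v) : ∃ D : RectilinearDrawing (⊤ : SimpleGraph V), D.pos = q := by
  refine ⟨⟨q, hinj, fun a b c hab hac hbc hcol =>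
    hq a b c hab hac hbc (orient_eq_zero_of_collinear hcol), ?_⟩, rfl⟩
  have share : ∀ x y w z, x ≠ y → x ≠ w → y ≠ w →
      z ∈ openSegment ℝ (q x) (q y) → z ∉ openSegment ℝ (q x) (q w) :=
    fun x y w z hxy hxw hyw => not_mem_openSegment_of_common_endpoint (hq x y w hxy hxw hyw)
  have disj : ∀ a b c d z, a ≠ b → c ≠ d → s(a, b) ≠ s(c, d) →
      z ∈ openSegment ℝ (q a) (q b) → z ∈ openSegment ℝ (q c) (q d) →
      a ≠ c ∧ a ≠ d ∧ b ≠ c ∧ b ≠ d := by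
    intro a b c d z hab hcd hne h1 h2
    have h1' : z ∈ openSegment ℝ (q b) (q a) := by rwa [openSegment_symm]
    have h2' : z ∈ openSegment ℝ (q d) (q c) := by rwa [openSegment_symm]
    refine ⟨?_, ?_, ?_, ?_⟩
    · rintro rfl
      exact share a b d z hab hcd (fun h => hne (by rw [h])) h1 h2
    · rintro rfl
      exact share a b c z hab hcd.symm (fun h => hne (by rw [h, Sym2.eq_swap])) h1 h2'
    · rintro rfl
      exact share b a d z hab.symm hcd (fun h => hne (by rw [h, Sym2.eq_swap])) h1' h2
    · rintro rfl
      exact share b a c z hab.symm hcd.symm (fun h => hne (by rw [h])) h1' h2'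
  intro e he f hf g hg hef heg hfg
  induction e using Sym2.ind with
  | _ a b =>
  induction f using Sym2.ind with
  | _ c d =>
  induction g using Sym2.ind with
  | _ u v =>
  rw [Set.eq_empty_iff_forall_notMem]
  rintro z ⟨⟨h1, h2⟩, h3⟩
  rw [edgeInterior_mk] at h1 h2 h3
  have hab : a ≠ b := by simpa using he
  have hcd : c ≠ d := by simpa using hf
  have huv : u ≠ v := by simpa using hg
  have d1 := disj a b c d z hab hcd hef h1 h2
  have d2 := disj a b u v z hab huv heg h1 h3
  have d3 := disj c d u v z hcd huv hfg h2 h3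
  refine hq' a b c d u v ?_ ⟨z, ⟨h1, h2⟩, h3⟩
  simp only [List.nodup_cons, List.mem_cons, List.not_mem_nil, or_false, not_or,
    not_false_eq_true, List.nodup_nil, and_true]
  tauto

/-- Realization of prescribed orientations by a rectilinear drawing. -/
theorem HasFlippedOrient.exists_drawing {S : Finset ℕ} {n r : ℕ}
    {p : ℕ → EuclideanSpace ℝ (Fin 2)} (h : HasFlippedOrient S n r p) :
    ∃ p', HasFlippedOrient S n r p' ∧
      ∃ D : RectilinearDrawing (⊤ : SimpleGraph (Fin n)), ∀ v : Fin n, D.pos v = p' v := by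
  rcases Nat.lt_or_ge n 3 with hn | hn
  · refine ⟨fun k => parabola k, fun a b c _ _ _ => by omega, ?_⟩
    have hlen : ∀ l : List (Fin n), l.Nodup → l.length < 3 := fun l hl => by
      have := hl.length_le_card
      rw [Fintype.card_fin] at this
      omega
    obtain ⟨D, hD⟩ := exists_rectilinearDrawing (fun v : Fin n => parabola (v : ℕ))
      (fun a b hab => by
        have := congrArg (fun x : EuclideanSpace ℝ (Fin 2) => x 0) hab
        simp only [parabola] at this
        simpa [Fin.ext_iff] using this)
      (fun a b c hab hac hbc => absurd (hlen [a, b, c] (by simp [hab, hac, hbc])) (by simp))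
      (fun v u a b c d hnd => absurd (hlen _ hnd) (by simp))
    exact ⟨D, fun v => by rw [hD]⟩
  have hp : SameOrient (fun v : Fin n => p v) (fun v : Fin n => p v) := fun a b c hab hac hbc =>
    mul_self_pos.2 (h.ne_zero a.2 b.2 c.2 (Fin.val_ne_of_ne hab) (Fin.val_ne_of_ne hac)
      (Fin.val_ne_of_ne hbc))
  obtain ⟨q, hpq, hq⟩ := exists_sameOrient_noTriple _ hp
  have hne : ∀ a b c, a ≠ b → a ≠ c → b ≠ c → orient (q a) (q b) (q c) ≠ 0 :=
    fun a b c hab hac hbc h0 => by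
      have := hpq a b c hab hac hbc
      rw [h0, mul_zero] at this
      exact lt_irrefl _ this
  obtain ⟨D, hD⟩ := exists_rectilinearDrawing q (fun a b hab => by
    by_contra hab'
    obtain ⟨c, hc⟩ : ∃ c : Fin n, c ∉ ({a, b} : Finset (Fin n)) := by
      by_contra! hall
      have h1 := Finset.card_le_card (fun x _ => hall x : Finset.univ ⊆ ({a, b} : Finset (Fin n)))
      have h2 := Finset.card_le_two (a := a) (b := b)
      rw [Finset.card_univ, Fintype.card_fin] at h1
      omega
    simp only [Finset.mem_insert, Finset.mem_singleton, not_or] at hc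
    exact hne a b c hab' (Ne.symm hc.1) (Ne.symm hc.2) (by rw [hab, orient_self])) hne hq
  refine ⟨fun k => if hk : k < n then q ⟨k, hk⟩ else 0, ?_, D, fun v => by simp [hD]⟩
  intro a b c hab hbc hc
  have hs := hpq ⟨a, by omega⟩ ⟨b, by omega⟩ ⟨c, hc⟩ (by simp; omega) (by simp; omega)
    (by simp; omega)
  simp only [hc, hbc.trans hc, hab.trans (hbc.trans hc), dite_true]
  exact ⟨fun hf => neg_of_mul_pos_right hs ((h a b c hab hbc hc).1 hf).le,
    fun hf => pos_of_mul_pos_right hs ((h a b c hab hbc hc).2 hf).le⟩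

/-- Every chord from a moved vertex has the same number of crossings. -/
theorem exists_drawing_card_le {S : Finset ℕ} {n m r : ℕ} (hr : r + 2 ≤ n)
    (h1 : AvoidsDiff {1, r + 1, n - r - 1} S) (hS : ∀ i ∈ S, IsChord S n m r i) :
    ∃ D : RectilinearDrawing (⊤ : SimpleGraph (Fin n)),
      S.card ≤ D.crossingIndex ((m - 1) * (n - 1 - m) - r) := by
  obtain ⟨p, hp⟩ := exists_hasFlippedOrient hr h1
  obtain ⟨q, hq, D, hD⟩ := hp.exists_drawing
  refine ⟨D, ?_⟩
  let e : S → Sym2 (Fin n) := fun i =>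
    s(⟨i, by have := (hS i i.2).end_lt; omega⟩, ⟨i + m, (hS i i.2).end_lt⟩)
  have he : Function.Injective e := by
    rintro ⟨i, hi⟩ ⟨j, hj⟩ hij
    simp only [e, Sym2.eq_iff, Fin.mk.injEq] at hij
    rw [Subtype.mk.injEq]
    omega
  have hsub : Set.range e ⊆ D.crossingSet ((m - 1) * (n - 1 - m) - r) := by
    rintro _ ⟨⟨i, hi⟩, rfl⟩
    have hc := hS i hi
    have := hc.one_le
    refine ⟨by simp [e]; omega, ?_⟩
    simp only [e]
    rw [encard_crossingsOn D hD hq hc, card_crossingPairs hc.one_le hc.add_lt hc.eq_zero hc.end_lt]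
  have := Set.ncard_le_ncard hsub (Set.toFinite _)
  rwa [← Set.image_univ, Set.ncard_image_of_injective _ he, Set.ncard_univ,
    Nat.card_eq_fintype_card, Fintype.card_coe] at this

/-! ### Choice of parameters and conclusion -/

theorem exists_chord_length {n k : ℕ} (hn : 2 ≤ n) (hk : k ≤ ⌊((n : ℝ) - 2) ^ 2 / 4⌋₊) :
    ∃ m r, 1 ≤ m ∧ 2 * m ≤ n ∧ m + r < n ∧ r + 2 ≤ n ∧ (m = 1 → r = 0) ∧
      (m - 1) * (n - 1 - m) - r = k := by
  have hmax : k ≤ (n / 2 - 1) * (n - 1 - n / 2) := by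
    -- The bound is `h * h` or `h * (h + 1)` according to parity, the value of the product at `m = n
    -- / 2`.
    obtain ⟨h, hh⟩ : ∃ h, n = 2 * h + 2 ∨ n = 2 * h + 3 := ⟨(n - 2) / 2, by omega⟩
    have hk' : (k : ℝ) ≤ ((n : ℝ) - 2) ^ 2 / 4 :=
      (Nat.le_floor_iff (by positivity)).1 hk
    rcases hh with rfl | rfl
    · rw [show (2 * h + 2) / 2 - 1 = h by omega, show 2 * h + 2 - 1 - (2 * h + 2) / 2 = h by omega]
      have : (k : ℝ) ≤ (h * h : ℕ) := by push_cast at hk' ⊢; linarith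
      exact_mod_cast this
    · rw [show (2 * h + 3) / 2 - 1 = h by omega,
        show 2 * h + 3 - 1 - (2 * h + 3) / 2 = h + 1 by omega]
      have : (k : ℝ) < (h * (h + 1) + 1 : ℕ) := by push_cast at hk' ⊢; linarith
      have : k < h * (h + 1) + 1 := by exact_mod_cast this
      omega
  have hex : ∃ m, 1 ≤ m ∧ k ≤ (m - 1) * (n - 1 - m) := ⟨n / 2, by omega, hmax⟩
  classical
  obtain ⟨hm1, hmk⟩ := Nat.find_spec hex
  have hmn : Nat.find hex ≤ n / 2 := Nat.find_min' hex ⟨by omega, hmax⟩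
  have hmin := fun j => Nat.find_min hex (m := j)
  generalize Nat.find hex = m at *
  refine ⟨m, (m - 1) * (n - 1 - m) - k, hm1, by omega, ?_⟩
  obtain ⟨t, rfl⟩ : ∃ t, n = 2 * m + t := ⟨n - 2 * m, by omega⟩
  obtain ⟨l, rfl⟩ : ∃ l, m = l + 1 := ⟨m - 1, by omega⟩
  rcases Nat.eq_zero_or_pos l with rfl | hl
  · simp at hmk ⊢
    omega
  · have h2 := hmin l (by omega)
    obtain ⟨j, rfl⟩ : ∃ j, l = j + 1 := ⟨l - 1, by omega⟩
    rw [show 2 * (j + 1 + 1) + t - 1 - (j + 1 + 1) = j + 1 + t by omega,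
      show j + 1 + 1 - 1 = j + 1 by omega] at *
    rw [show 2 * (j + 1 + 1) + t - 1 - (j + 1) = j + 2 + t by omega,
      show j + 1 - 1 = j by omega] at h2
    have h3 : j * (j + 2 + t) < k := by
      by_contra! h; exact h2 ⟨by omega, h⟩
    -- The products for `m - 1` and `m` differ by `t + 1 = n - 2 * m + 1`, so minimality of `m`
    -- forces `r ≤ n - 2 * m`.
    have h4 : (j + 1) * (j + 1 + t) = j * (j + 2 + t) + (t + 1) := by ring
    omega

theorem mainTheorem3 :
    ∃ c : ℝ, 0 < c ∧ ∀ n k : ℕ, n ≠ 1 → k ≤ ⌊((n : ℝ) - 2) ^ 2 / 4⌋₊ →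
      ∃ D : RectilinearDrawing (⊤ : SimpleGraph (Fin n)), c * (n : ℝ) ≤ (D.crossingIndex k : ℝ) := by
  -- Five forbidden differences give `n - m ≤ 11 * S.card`, and `n ≤ 2 * (n - m)`.
  refine ⟨1 / 22, by norm_num, fun n k hn hk => ?_⟩
  rcases Nat.eq_zero_or_pos n with rfl | hpos
  · exact ⟨⟨Fin.elim0, fun a => a.elim0, fun a => a.elim0, fun e => Sym2.ind (fun a => a.elim0) e⟩,
      by simp⟩
  obtain ⟨m, r, hm1, hmn, hmr, hr, hm0, rfl⟩ := exists_chord_length (by omega) hk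
  -- The differences `1`, `r + 1`, `n - r - 1` keep the pushes independent; `m` and `m - 1` keep the
  -- far end of a chord and its predecessor unpushed. For `m = 1` the entry `m - 1` is `0`, a
  -- difference that would force `S` to be empty and that `erase` discards.
  obtain ⟨S, hSN, hS, hcard⟩ := exists_avoidsDiff {1, m, m - 1, r + 1, n - r - 1} (n - m)
  have hD5 : ({1, m, m - 1, r + 1, n - r - 1} : Finset ℕ).card ≤ 5 := Finset.card_le_five
  have h0 : ∀ i ∈ S, ∀ d, d ≠ 0 → d ∈ ({1, m, m - 1, r + 1, n - r - 1} : Finset ℕ) → i + d ∉ S :=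
    fun i hi d hd hd' => hS i hi d (Finset.mem_erase.2 ⟨hd, hd'⟩)
  have hA : AvoidsDiff {1, r + 1, n - r - 1} S := by
    intro i hi d hd
    simp only [Finset.mem_insert, Finset.mem_singleton] at hd
    refine h0 i hi d (by omega) ?_
    simp only [Finset.mem_insert, Finset.mem_singleton]
    tauto
  have hB : ∀ i ∈ S, IsChord S n m r i := by
    intro i hi
    have := Finset.mem_range.1 (hSN hi)
    refine ⟨hm1, hmr, hm0, by omega, hi, ?_, ?_, ?_⟩
    · rintro j hj rfl
      exact h0 j hj 1 one_ne_zero (by simp) hi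
    · exact h0 i hi m (by omega) (by simp)
    · intro h2 j hj hji
      obtain rfl : j = i + (m - 1) := by omega
      exact h0 i hi (m - 1) (by omega) (by simp) hj
  obtain ⟨D, hD⟩ := exists_drawing_card_le hr hA hB
  refine ⟨D, ?_⟩
  have h1 : n ≤ 22 * D.crossingIndex ((m - 1) * (n - 1 - m) - r) := by
    have := Nat.mul_le_mul_left S.card (show
      2 * ({1, m, m - 1, r + 1, n - r - 1} : Finset ℕ).card + 1 ≤ 11 by omega)
    omega
  have h2 : (n : ℝ) ≤ 22 * (D.crossingIndex ((m - 1) * (n - 1 - m) - r) : ℝ) := by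
    exact_mod_cast h1
  linarith
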